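/- Let $m\ge 1$, let $g\in C^\infty([0,+\infty))$ satisfy $g>0$ on $(0,+\infty)$, $g'(0)=1$ and $g^{(2k)}(0)=0$ for every $k\ge 0$, and let $M_g$ be the model manifold $\mathbb{R}^m$ with the metric that in polar coordinates $(r,\theta)$ centred at the origin $o$ reads $dr^2+g(r)^2d\theta^2$, where $d\theta^2$ is the standard metric of $\mathbb{S}^{m-1}$. Assume that $g$ is nondecreasing. Let $p>1$ and let $\varphi\in C^0([0,+\infty))\cap C^1((0,+\infty))$ satisfy $\varphi(0)=0$, $\varphi>0$ on $(0,+\infty)$ and $$a_2^{-1}t^{p-1}\le t\varphi'(t)\le a_1+a_2t^{p-1}\qquad (t>0)$$ for some constants $a_1,a_2>0$. Let $B:\mathbb{R}\to\mathbb{R}$ be nondecreasing, continuous on $[0,+\infty)$, with $B(0)=0$, $B\ge 0$ on $(0,+\infty)$, $B=0$ on $(-\infty,0)$ and, for some $b_1>0$, $B(t)\le b_1t^{p-1}$ for all $t>0$. Put $L_\varphi u=\operatorname{div}\big(\varphi(|\nabla u|)|\nabla u|^{-1}\nabla u\big)$ and write $B_\rho=\{r<\rho\}$. Then for all $0<R<R_1$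 and $\varepsilon>0$ there is a function $u=z\circ r$ on $M_g\setminus B_R$, with $z\in C^1([R,+\infty))$ and $z'>0$ (in particular $z$ is strictly increasing), such that - $u$ is a weak solution of $L_\varphi u=B(u)$ on $M_g\setminus\overline{B_R}$, that is, $u\in W^{1,p}_{\mathrm{loc}}(M_g\setminus\overline{B_R})$ and $$\int \Big\langle \frac{\varphi(|\nabla u|)}{|\nabla u|}\nabla u,\nabla\psi\Big\rangle+\int B(u)\psi=0\qquad\text{for all }\psi\in C^\infty_c(M_g\setminus\overline{B_R}),$$ with respect to the Riemannian measure, both integrals being absolutely convergent (the vector field $\varphi(|\nabla u|)|\nabla u|^{-1}\nabla u$ is read as $0$ where $\nabla u=0$); moreover the profile $z$ solves $\big[g^{m-1}\varphi(z')\big]'=g^{m-1}B(z)$ on the whole of $[R,+\infty)$; - $u>0$ on $M_g\setminus\overline{B_R}$; - $u=0$ on $\partial B_R$; - $u<\varepsilon$ on $B_{R_1}\setminus B_R$. -/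

import Mathlib

open MeasureTheory Set
open scoped ContDiff Matrix

noncomputable section

/-- A Riemannian metric on `ℝᵐ`, given by its matrix `(G x)ᵢⱼ` in the Cartesian coordinates. -/
abbrev MetricField (m : ℕ) : Type :=
  EuclideanSpace ℝ (Fin m) → Matrix (Fin m) (Fin m) ℝ

namespace MetricField

variable {m : ℕ}

/-- The inner product `⟨X, Y⟩` of two tangent vectors at `x`. -/
def inner (G : MetricField m) (x : EuclideanSpace ℝ (Fin m)) (X Y : Fin m → ℝ) : ℝ :=
  X ⬝ᵥ (G x *ᵥ Y)

/-- The length `|X|` of a tangent vector at `x`. -/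
def length (G : MetricField m) (x : EuclideanSpace ℝ (Fin m)) (X : Fin m → ℝ) : ℝ :=
  Real.sqrt (G.inner x X X)

/-- The tangent vector dual to the covector `ξ = (ξ₁, …, ξₘ)`: its components are `Σⱼ gⁱʲ ξⱼ`.
The gradient of a function `u` is `sharp` of its partial derivatives. -/
def sharp (G : MetricField m) (x : EuclideanSpace ℝ (Fin m)) (ξ : Fin m → ℝ) : Fin m → ℝ :=
  (G x)⁻¹ *ᵥ ξ

/-- The Riemannian measure `√(det G) dx`. -/
def vol (G : MetricField m) : Measure (EuclideanSpace ℝ (Fin m)) :=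
  volume.withDensity fun x => ENNReal.ofReal (Real.sqrt (G x).det)

end MetricField

/-- The partial derivatives of `ψ` in the Cartesian coordinates. -/
def partials {m : ℕ} (ψ : EuclideanSpace ℝ (Fin m) → ℝ) (x : EuclideanSpace ℝ (Fin m)) :
    Fin m → ℝ :=
  fun i => fderiv ℝ ψ x (EuclideanSpace.single i 1)

/-- `ψ ∈ C_c^∞(Ω)`. -/
structure IsTestFunction {m : ℕ} (Ω : Set (EuclideanSpace ℝ (Fin m)))
    (ψ : EuclideanSpace ℝ (Fin m) → ℝ) : Prop where
  smooth : ContDiff ℝ ∞ ψ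
  compact : HasCompactSupport ψ
  support : tsupport ψ ⊆ Ω

/-- `u ∈ W^{1,p}_loc(Ω)`, with weak partial derivatives `ξ₁, …, ξₘ`. -/
structure HasWeakPartials {m : ℕ} (p : ℝ) (Ω : Set (EuclideanSpace ℝ (Fin m)))
    (u : EuclideanSpace ℝ (Fin m) → ℝ) (ξ : EuclideanSpace ℝ (Fin m) → Fin m → ℝ) : Prop where
  memLp_fun : ∀ K, IsCompact K → K ⊆ Ω → MemLp u (ENNReal.ofReal p) (volume.restrict K)
  memLp_partial : ∀ K, IsCompact K → K ⊆ Ω → ∀ i,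
    MemLp (fun x => ξ x i) (ENNReal.ofReal p) (volume.restrict K)
  integral_eq : ∀ ψ, IsTestFunction Ω ψ → ∀ i,
    ∫ x, u x * partials ψ x i = - ∫ x, ξ x i * ψ x

/-- The bundle map `A(X) = φ(|X|) |X|⁻¹ X` (with `A(0) = 0`) of the operator
`L_φ u = div (φ(|∇u|) |∇u|⁻¹ ∇u)`. -/
def phiFlux {m : ℕ} (G : MetricField m) (φ : ℝ → ℝ) (x : EuclideanSpace ℝ (Fin m))
    (X : Fin m → ℝ) : Fin m → ℝ :=
  (φ (G.length x X) / G.length x X) • X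

/-- `u ∈ W^{1,p}_loc(Ω)` is a weak solution of `L_φ u = B(u)` on `Ω`:
`∫ ⟨A(∇u), ∇ψ⟩ + ∫ B(u) ψ = 0` for all `ψ ∈ C_c^∞(Ω)`, the integrals being with respect to the
Riemannian measure and both of them convergent. -/
def IsWeakSolution {m : ℕ} (G : MetricField m) (p : ℝ) (φ B : ℝ → ℝ)
    (Ω : Set (EuclideanSpace ℝ (Fin m))) (u : EuclideanSpace ℝ (Fin m) → ℝ) : Prop :=
  ∃ ξ : EuclideanSpace ℝ (Fin m) → Fin m → ℝ, HasWeakPartials p Ω u ξ ∧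
    ∀ ψ, IsTestFunction Ω ψ →
      Integrable (fun x => G.inner x (phiFlux G φ x (G.sharp x (ξ x))) (G.sharp x (partials ψ x)))
        G.vol ∧
      Integrable (fun x => B (u x) * ψ x) G.vol ∧
      (∫ x, G.inner x (phiFlux G φ x (G.sharp x (ξ x))) (G.sharp x (partials ψ x)) ∂G.vol)
        + ∫ x, B (u x) * ψ x ∂G.vol = 0

/-- The conditions on the function `g` that defines a model manifold `M_g`. -/
structure IsModelFunction (g : ℝ → ℝ) : Prop where
  smooth : ContDiffOn ℝ ∞ g (Ici 0)
  pos : ∀ r, 0 < r → 0 < g r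
  deriv_zero : derivWithin g (Ici 0) 0 = 1
  even_deriv_zero : ∀ k : ℕ, iteratedDerivWithin (2 * k) g (Ici 0) 0 = 0

open Classical in
/-- The metric `dr² + g(r)² dθ²` of the model manifold `M_g = ℝᵐ` with origin `0`, in Cartesian
coordinates: for `x ≠ 0` and `r = ‖x‖` one has `(dr²)ᵢⱼ = xᵢ xⱼ / r²`, and the pullback of the
standard metric of the unit sphere by `x ↦ x / r` is `(dθ²)ᵢⱼ = (δᵢⱼ - xᵢ xⱼ / r²) / r²`.
At the origin it is extended by continuity. -/
def modelMetric (m : ℕ) (g : ℝ → ℝ) : MetricField m := fun x =>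
  if x = 0 then 1
  else Matrix.of fun i j =>
    x i * x j / ‖x‖ ^ 2 +
      g ‖x‖ ^ 2 * (((1 : Matrix (Fin m) (Fin m) ℝ) i j - x i * x j / ‖x‖ ^ 2) / ‖x‖ ^ 2)

end

/-! For u = z(r) the equation reduces to (G φ(z'))' = G B(z) with G = g^(m-1). Prescribe z(R) = 0
and an initial flux G φ(z') = c > 0 at R. With χ the inverse of φ, two integrations turn the problem
into a fixed point equation z = T z (`radialOperator`). Since B ≥ 0, the flux stays at least c, so
z' > 0 and the points where the gradient vanishes are never met.

Neither B nor χ need be Lipschitz, so order replaces contraction: B and χ are nondecreasing, hence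
so is T, and the supremum of the nondecreasing f with f ≤ T f lying below a supersolution w is a
fixed point, as in Knaster–Tarski (`exists_radialOperator_fixedPoint`). For q = p - 1, the bounds
B(t) ≤ b t^q and χ(s)^q ≤ κ s together with the monotonicity of G make w = δ e^(λ(r-R)) a
supersolution for λ large, independently of δ (`radialOperator_exp_le`). This gives existence on all
of [R, ∞), and a small δ gives z < ε up to R₁.

The passage to the weak equation uses that the metric fixes radial vectors and has density
(g/r)^(m-1). Weighted by this density, the flux becomes the Euclidean field H(r) r^(-m) x with H = G
φ(z'), and integration by parts concludes (`integral_radialField_mul_partials`). -/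

/-! ### Inversion and growth of φ. -/

/-- A strictly increasing function on `[0, ∞)` that dominates a multiple of a power has a
continuous nondecreasing inverse with the reversed bound. -/
theorem exists_continuous_monotone_inverse {φ : ℝ → ℝ} {q κ : ℝ} (hq : 0 < q) (hκ : 0 < κ)
    (hcont : ContinuousOn φ (Ici 0)) (hzero : φ 0 = 0) (hmono : StrictMonoOn φ (Ici 0))
    (hlower : ∀ t, 0 ≤ t → t ^ q ≤ κ * φ t) :
    ∃ χ : ℝ → ℝ, Continuous χ ∧ Monotone χ ∧
      ∀ s, 0 < s → 0 < χ s ∧ φ (χ s) = s ∧ χ s ^ q ≤ κ * s := by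
  -- Extending φ by the identity on the negative half-line gives an increasing bijection of ℝ; its
  -- inverse is an order isomorphism, so continuity is automatic.
  set F : ℝ → ℝ := fun t => φ (max 0 t) + min 0 t with hF
  have hFpos : ∀ t, 0 ≤ t → F t = φ t := fun t ht => by simp [hF, ht]
  have hFneg : ∀ t, t ≤ 0 → F t = t := fun t ht => by simp [hF, ht, hzero]
  have hFmono : StrictMono F := by
    intro a b hab
    have h1 : φ (max 0 a) ≤ φ (max 0 b) :=
      hmono.monotoneOn (mem_Ici.2 (le_max_left _ _)) (mem_Ici.2 (le_max_left _ _))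
        (max_le_max le_rfl hab.le)
    have h2 : min 0 a ≤ min 0 b := min_le_min le_rfl hab.le
    rcases lt_or_ge a 0 with ha | ha
    · have : min 0 a < min 0 b := by
        rw [min_eq_right ha.le]; exact lt_min ha hab
      simp only [hF]; linarith
    · rw [hFpos a ha, hFpos b (ha.trans hab.le)]
      exact hmono ha (ha.trans hab.le) hab
  have hFcont : Continuous F := by
    refine Continuous.add ?_ (by fun_prop)
    exact hcont.comp_continuous (by fun_prop) fun t => mem_Ici.2 (le_max_left _ _)
  have hFsurj : Function.Surjective F := by
    refine hFcont.surjective ?_ ?_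
    · refine Filter.tendsto_atTop_mono' _ (f₁ := fun t => t ^ q / κ) ?_
        ((tendsto_rpow_atTop hq).atTop_div_const hκ)
      filter_upwards [Filter.eventually_ge_atTop 0] with t ht
      rw [hFpos t ht, div_le_iff₀' hκ]
      exact hlower t ht
    · refine Filter.tendsto_id.congr' ?_
      filter_upwards [Filter.eventually_le_atBot 0] with t ht
      exact (hFneg t ht).symm
  set e := hFmono.orderIsoOfSurjective F hFsurj with he
  have heF : ∀ s, F (e.symm s) = s := fun s => e.apply_symm_apply s
  refine ⟨e.symm, e.symm.continuous, e.symm.monotone, fun s hs => ?_⟩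
  have hpos : 0 < e.symm s := by
    by_contra! h
    have := heF s
    rw [hFneg _ h] at this
    linarith
  have hφ : φ (e.symm s) = s := by rw [← hFpos _ hpos.le]; exact heF s
  refine ⟨hpos, hφ, ?_⟩
  have := hlower _ hpos.le
  rwa [hφ] at this

/-- A function on `[0, ∞)` with `t φ'(t) ≥ a⁻¹ t ^ q` is strictly increasing and dominates
`t ^ q / (a q)`. -/
theorem strictMonoOn_and_rpow_le_of_rpow_le_mul_deriv {φ : ℝ → ℝ} {q a : ℝ} (hq : 0 < q)
    (ha : 0 < a) (hcont : ContinuousOn φ (Ici 0)) (hzero : φ 0 = 0)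
    (hdiff : DifferentiableOn ℝ φ (Ioi 0)) (hlower : ∀ t, 0 < t → a⁻¹ * t ^ q ≤ t * deriv φ t) :
    StrictMonoOn φ (Ici 0) ∧ ∀ t, 0 ≤ t → t ^ q ≤ a * q * φ t := by
  constructor
  · refine strictMonoOn_of_deriv_pos (convex_Ici 0) hcont fun t ht => ?_
    rw [interior_Ici] at ht
    have ht : 0 < t := ht
    have h : 0 < t * deriv φ t := lt_of_lt_of_le (by positivity) (hlower t ht)
    exact pos_of_mul_pos_right h ht.le
  · have hd : ∀ t, 0 < t → HasDerivAt (fun t => a * q * φ t - t ^ q)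
        (a * q * deriv φ t - q * t ^ (q - 1)) t := fun t ht =>
      (((hdiff t ht).differentiableAt (Ioi_mem_nhds ht)).hasDerivAt.const_mul _).sub
        (Real.hasDerivAt_rpow_const (Or.inl ht.ne'))
    -- The lower bound on t φ'(t), multiplied by a q / t, says exactly that this difference has
    -- nonnegative derivative.
    have hmono : MonotoneOn (fun t => a * q * φ t - t ^ q) (Ici 0) := by
      refine monotoneOn_of_deriv_nonneg (convex_Ici 0) ?_ ?_ ?_
      · exact (hcont.const_mul _ |>.sub (Real.continuous_rpow_const hq.le).continuousOn)
      · rw [interior_Ici]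
        exact fun t ht => (hd t ht).differentiableAt.differentiableWithinAt
      · intro t ht
        rw [interior_Ici] at ht
        have ht : 0 < t := ht
        rw [(hd t ht).deriv, Real.rpow_sub_one ht.ne']
        have h := hlower t ht
        rw [inv_mul_le_iff₀ ha] at h
        have h' : t ^ q / t ≤ a * deriv φ t := by
          rw [div_le_iff₀ ht]; linarith
        nlinarith [mul_le_mul_of_nonneg_left h' hq.le]
    intro t ht
    have := hmono (mem_Ici.2 le_rfl) ht ht
    simp only [hzero, Real.zero_rpow hq.ne'] at this
    linarith

/-! ### The integral operator, its fixed points and a supersolution. -/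

/-- The integral operator whose fixed points are the solutions `z` of `(G φ(z'))' = G B(z)` with
`z(R) = 0` and `G φ(z') = c` at `R`; here `χ` is the inverse of `φ`. -/
noncomputable def radialOperator (G χ B : ℝ → ℝ) (c R : ℝ) (f : ℝ → ℝ) (r : ℝ) : ℝ :=
  ∫ s in R..max R r, χ ((c + ∫ t in R..s, G t * B (f t)) / G s)

section RadialOperator

variable {G χ B : ℝ → ℝ} {c R : ℝ}

theorem intervalIntegrable_mul_comp_monotone (hG : Continuous G) (hB : Monotone B) {f : ℝ → ℝ}
    (hf : Monotone f) (a b : ℝ) : IntervalIntegrable (fun t => G t * B (f t)) volume a b :=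
  ((hB.comp hf).intervalIntegrable).continuousOn_mul hG.continuousOn

theorem continuous_radialOperator_integrand (hG : Continuous G) (hGpos : ∀ s, 0 < G s)
    (hχ : Continuous χ) (hB : Monotone B) {f : ℝ → ℝ} (hf : Monotone f) :
    Continuous fun s => χ ((c + ∫ t in R..s, G t * B (f t)) / G s) := by
  refine hχ.comp (Continuous.div ?_ hG fun s => (hGpos s).ne')
  exact continuous_const.add
    (intervalIntegral.continuous_primitive (intervalIntegrable_mul_comp_monotone hG hB hf) R)

theorem radialOperator_integrand_arg_pos (hGpos : ∀ s, 0 < G s) (hB0 : ∀ t, 0 ≤ B t) (hc : 0 < c)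
    (f : ℝ → ℝ) {s : ℝ} (hs : R ≤ s) : 0 < (c + ∫ t in R..s, G t * B (f t)) / G s := by
  refine div_pos (add_pos_of_pos_of_nonneg hc ?_) (hGpos s)
  exact intervalIntegral.integral_nonneg hs fun t _ => mul_nonneg (hGpos t).le (hB0 _)

theorem radialOperator_mono (hG : Continuous G) (hGpos : ∀ s, 0 < G s) (hχ : Continuous χ)
    (hχm : Monotone χ) (hB : Monotone B) {f h : ℝ → ℝ} (hf : Monotone f) (hh : Monotone h)
    (hfh : f ≤ h) : radialOperator G χ B c R f ≤ radialOperator G χ B c R h := by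
  intro r
  refine intervalIntegral.integral_mono_on (le_max_left _ _)
    ((continuous_radialOperator_integrand hG hGpos hχ hB hf).intervalIntegrable _ _)
    ((continuous_radialOperator_integrand hG hGpos hχ hB hh).intervalIntegrable _ _) ?_
  intro s hs
  refine hχm (div_le_div_of_nonneg_right (add_le_add_right ?_ c) (hGpos s).le)
  exact intervalIntegral.integral_mono_on hs.1 (intervalIntegrable_mul_comp_monotone hG hB hf _ _)
    (intervalIntegrable_mul_comp_monotone hG hB hh _ _)
    fun t _ => mul_le_mul_of_nonneg_left (hB (hfh t)) (hGpos t).le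

/-- The integrand is positive on [R, ∞), and the upper limit `max R r` makes the image vanish left
of R. Monotonicity is thus preserved on the whole line, and it is what makes B ∘ f integrable in the
next iterate. -/
theorem monotone_radialOperator (hG : Continuous G) (hGpos : ∀ s, 0 < G s) (hχ : Continuous χ)
    (hχ0 : ∀ s, 0 < s → 0 < χ s) (hB : Monotone B) (hB0 : ∀ t, 0 ≤ B t) (hc : 0 < c)
    {f : ℝ → ℝ} (hf : Monotone f) : Monotone (radialOperator G χ B c R f) := by
  intro a b hab
  have hk := continuous_radialOperator_integrand (c := c) (R := R) hG hGpos hχ hB hf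
  unfold radialOperator
  rw [← sub_nonneg, intervalIntegral.integral_interval_sub_left (hk.intervalIntegrable _ _)
    (hk.intervalIntegrable _ _)]
  refine intervalIntegral.integral_nonneg (max_le_max le_rfl hab) fun s hs => ?_
  exact (hχ0 _ (radialOperator_integrand_arg_pos hGpos hB0 hc f
    ((le_max_left _ _).trans hs.1))).le

theorem radialOperator_nonneg (hGpos : ∀ s, 0 < G s)
    (hχ0 : ∀ s, 0 < s → 0 < χ s) (hB0 : ∀ t, 0 ≤ B t) (hc : 0 < c)
    (f : ℝ → ℝ) (r : ℝ) : 0 ≤ radialOperator G χ B c R f r :=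
  intervalIntegral.integral_nonneg (le_max_left _ _) fun _ hs =>
    (hχ0 _ (radialOperator_integrand_arg_pos hGpos hB0 hc f hs.1)).le

/-- Below a nondecreasing supersolution the radial operator has a fixed point. -/
theorem exists_radialOperator_fixedPoint (hG : Continuous G) (hGpos : ∀ s, 0 < G s)
    (hχ : Continuous χ) (hχm : Monotone χ) (hχ0 : ∀ s, 0 < s → 0 < χ s)
    (hB : Monotone B) (hB0 : ∀ t, 0 ≤ B t) (hc : 0 < c) {w : ℝ → ℝ} (hw : Monotone w)
    (hw0 : ∀ r, 0 ≤ w r) (hTw : radialOperator G χ B c R w ≤ w) :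
    ∃ z : ℝ → ℝ, Monotone z ∧ (∀ r, z r ≤ w r) ∧ radialOperator G χ B c R z = z := by
  set T := radialOperator G χ B c R with hT
  -- Nondecreasing subsolutions below w; the zero function is one of them.
  set P : Set (ℝ → ℝ) := {f | Monotone f ∧ f ≤ w ∧ f ≤ T f} with hP
  have h0 : (fun _ => (0 : ℝ)) ∈ P :=
    ⟨monotone_const, hw0, radialOperator_nonneg hGpos hχ0 hB0 hc _⟩
  have : Nonempty P := ⟨⟨_, h0⟩⟩
  set z : ℝ → ℝ := fun r => ⨆ f : P, f.1 r with hz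
  have hbdd : ∀ r, BddAbove (range fun f : P => f.1 r) := fun r =>
    ⟨w r, by rintro _ ⟨f, rfl⟩; exact f.2.2.1 r⟩
  have hle : ∀ f ∈ P, f ≤ z := fun f hf r => le_ciSup (hbdd r) ⟨f, hf⟩
  have hzm : Monotone z := fun a b hab => ciSup_mono (hbdd b) fun f => f.2.1 hab
  have hzw : z ≤ w := fun r => ciSup_le fun f => f.2.2.1 r
  have hzT : z ≤ T z := fun r => ciSup_le fun f =>
    (f.2.2.2 r).trans (radialOperator_mono hG hGpos hχ hχm hB f.2.1 hzm (hle _ f.2) r)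
  have hTzm : Monotone (T z) := monotone_radialOperator hG hGpos hχ hχ0 hB hB0 hc hzm
  -- T z is again in P, hence T z ≤ z; the reverse inequality is `hzT`.
  refine ⟨z, hzm, hzw, le_antisymm (hle _ ⟨hTzm, ?_, ?_⟩) hzT⟩
  · exact (radialOperator_mono hG hGpos hχ hχm hB hzm hw hzw).trans hTw
  · exact radialOperator_mono hG hGpos hχ hχm hB hzm hTzm hzT

/-- An exponential is a supersolution of the radial operator if `B` grows at most like a power. -/
theorem radialOperator_exp_le {q κ b lam δ : ℝ} (hq : 0 < q) (hκ : 0 < κ)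
    (hlam : 1 ≤ lam) (hlam' : κ * b ≤ lam * q) (hδ : 0 < δ)
    (hG : Continuous G) (hGpos : ∀ s, 0 < G s) (hGm : Monotone G)
    (hχ : Continuous χ) (hχ0 : ∀ s, 0 < s → 0 < χ s) (hχq : ∀ s, 0 < s → χ s ^ q ≤ κ * s)
    (hB : Monotone B) (hB0 : ∀ t, 0 ≤ B t) (hBq : ∀ t, 0 < t → B t ≤ b * t ^ q)
    (hc : c = G R * ((lam * δ) ^ q / κ)) :
    radialOperator G χ B c R (fun r => δ * Real.exp (lam * (r - R))) ≤
      fun r => δ * Real.exp (lam * (r - R)) := by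
  have hlam0 : 0 < lam := one_pos.trans_le hlam
  set w : ℝ → ℝ := fun r => δ * Real.exp (lam * (r - R)) with hw
  have hwpos : ∀ r, 0 < w r := fun r => by positivity
  have hwm : Monotone w := fun a b hab => by
    simp only [hw]; gcongr
  have hwd : ∀ r, HasDerivAt w (lam * w r) r := fun r => by
    have h := ((((hasDerivAt_id r).sub_const R).const_mul lam).exp).const_mul δ
    refine h.congr_deriv ?_
    simp only [hw, id]; ring
  have hwc : Continuous w := by fun_prop
  have hwq : Continuous fun t => w t ^ q := hwc.rpow_const fun t => Or.inl (hwpos t).ne'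
  have hqd : ∀ r, HasDerivAt (fun r => w r ^ q / (lam * q)) (w r ^ q) r := fun r => by
    have h := ((hwd r).rpow_const (p := q) (Or.inl (hwpos r).ne')).div_const (lam * q)
    refine h.congr_deriv ?_
    rw [Real.rpow_sub_one (hwpos r).ne']
    have := (hwpos r).ne'
    field_simp
  have hc0 : 0 < c := by rw [hc]; have := hGpos R; positivity
  have hwR : w R = δ := by simp [hw]
  -- Since w' = λ w, this bounds the derivative of T w by that of w. Bounding G t by G s in the
  -- inner integral lets the weight cancel against the division by G s.
  have key : ∀ s, R ≤ s → χ ((c + ∫ t in R..s, G t * B (w t)) / G s) ≤ lam * w s := by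
    intro s hs
    have harg := radialOperator_integrand_arg_pos hGpos hB0 hc0 w hs
    refine (Real.rpow_le_rpow_iff (hχ0 _ harg).le (mul_pos hlam0 (hwpos s)).le hq).1
      ((hχq _ harg).trans ?_)
    have h1 : ∫ t in R..s, G t * B (w t) ≤ ∫ t in R..s, G s * b * w t ^ q := by
      refine intervalIntegral.integral_mono_on hs
        (intervalIntegrable_mul_comp_monotone hG hB hwm _ _)
        ((continuous_const.mul hwq).intervalIntegrable _ _) fun t ht => ?_
      rw [mul_assoc]
      exact mul_le_mul (hGm ht.2) (hBq _ (hwpos t)) (hB0 _) (hGpos s).le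
    rw [intervalIntegral.integral_const_mul, intervalIntegral.integral_eq_sub_of_hasDerivAt
      (fun t _ => hqd t) (hwq.intervalIntegrable _ _), hwR] at h1
    have h2 : c ≤ G s * ((lam * δ) ^ q / κ) := by
      rw [hc]; exact mul_le_mul_of_nonneg_right (hGm hs) (by positivity)
    have h3 : (c + ∫ t in R..s, G t * B (w t)) / G s ≤
        (lam * δ) ^ q / κ + b * (w s ^ q / (lam * q) - δ ^ q / (lam * q)) := by
      rw [div_le_iff₀ (hGpos s)]; linarith
    have h4 : δ ^ q ≤ w s ^ q :=
      Real.rpow_le_rpow hδ.le (by rw [← hwR]; exact hwm hs) hq.le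
    have h5 : 1 ≤ lam ^ q := Real.one_le_rpow hlam hq.le
    -- The two conditions on λ enter here: κ b / (λ q) ≤ 1 ≤ λ^q.
    have h6 : κ * b / (lam * q) ≤ lam ^ q := by
      refine le_trans ?_ h5
      rwa [div_le_one (by positivity)]
    calc κ * ((c + ∫ t in R..s, G t * B (w t)) / G s)
        ≤ κ * ((lam * δ) ^ q / κ + b * (w s ^ q / (lam * q) - δ ^ q / (lam * q))) := by gcongr
      _ = lam ^ q * δ ^ q + κ * b / (lam * q) * (w s ^ q - δ ^ q) := by
          rw [Real.mul_rpow hlam0.le hδ.le]; field_simp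
      _ ≤ lam ^ q * δ ^ q + lam ^ q * (w s ^ q - δ ^ q) := by
          gcongr
      _ = (lam * w s) ^ q := by
          rw [Real.mul_rpow hlam0.le (hwpos s).le]; ring
  intro r
  calc radialOperator G χ B c R w r ≤ ∫ s in R..max R r, lam * w s :=
        intervalIntegral.integral_mono_on (le_max_left _ _)
          ((continuous_radialOperator_integrand hG hGpos hχ hB hwm).intervalIntegrable _ _)
          ((hwc.const_mul lam).intervalIntegrable _ _) fun s hs => key s hs.1
    _ = w (max R r) - w R := intervalIntegral.integral_eq_sub_of_hasDerivAt
          (fun t _ => hwd t) ((hwc.const_mul lam).intervalIntegrable _ _)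
    _ ≤ w r := by
        rcases le_total R r with h | h
        · rw [max_eq_right h]; linarith [hwpos R]
        · rw [max_eq_left h]; linarith [hwpos r]

end RadialOperator

/-! ### The radial profile. -/

/-- Positive solutions of `(G φ(z'))' = G B(z)` on `[R, ∞)` that vanish at `R` and are as small as
desired on a bounded interval. -/
theorem exists_radial_profile {φ B G : ℝ → ℝ} {q κ b R R₁ ε : ℝ} (hq : 0 < q) (hκ : 0 < κ)
    (hb : 0 < b) (hε : 0 < ε) (hφ_cont : ContinuousOn φ (Ici 0)) (hφ_zero : φ 0 = 0)
    (hφ_mono : StrictMonoOn φ (Ici 0)) (hφ_lower : ∀ t, 0 ≤ t → t ^ q ≤ κ * φ t)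
    (hB_cont : Continuous B) (hB : Monotone B) (hB0 : ∀ t, 0 ≤ B t)
    (hBq : ∀ t, 0 < t → B t ≤ b * t ^ q)
    (hG : Continuous G) (hGpos : ∀ s, 0 < G s) (hGm : Monotone G) :
    ∃ z z' H : ℝ → ℝ, Continuous z' ∧ (∀ r, HasDerivAt z (z' r) r) ∧ z R = 0 ∧
      (∀ r, R ≤ r → 0 < z' r ∧ H r = G r * φ (z' r)) ∧ (∀ r, HasDerivAt H (G r * B (z r)) r) ∧
      ∀ r, R ≤ r → r < R₁ → z r < ε := by
  obtain ⟨χ, hχ, hχm, hχφ⟩ :=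
    exists_continuous_monotone_inverse hq hκ hφ_cont hφ_zero hφ_mono hφ_lower
  set lam : ℝ := 1 + κ * b / q with hlam
  have hlam1 : 1 ≤ lam := by rw [hlam]; have : 0 < κ * b / q := by positivity
                             linarith
  have hlam2 : κ * b ≤ lam * q := by
    rw [hlam, add_mul, div_mul_cancel₀ _ hq.ne']; linarith
  -- Normalised so that the supersolution equals ε at R₁.
  set δ : ℝ := ε * Real.exp (-(lam * (R₁ - R))) with hδ
  have hδ0 : 0 < δ := by positivity
  have hχ0 : ∀ s, 0 < s → 0 < χ s := fun s hs => (hχφ s hs).1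
  set c := G R * ((lam * δ) ^ q / κ) with hc
  have hc0 : 0 < c := by have := hGpos R; positivity
  have hw := radialOperator_exp_le (c := c) (R := R) hq hκ hlam1 hlam2 hδ0 hG hGpos hGm hχ
    hχ0 (fun s hs => (hχφ s hs).2.2) hB hB0 hBq hc
  obtain ⟨z, hzm, hzw, hzT⟩ := exists_radialOperator_fixedPoint hG hGpos hχ hχm hχ0 hB hB0 hc0
    (fun a b hab => by gcongr) (fun r => by positivity) hw
  set k : ℝ → ℝ := fun s => χ ((c + ∫ t in R..s, G t * B (z t)) / G s) with hk
  have hkc : Continuous k := continuous_radialOperator_integrand hG hGpos hχ hB hzm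
  -- The fixed point z is zero left of R and has a corner there. F agrees with it on [R, ∞) and is
  -- C¹ on ℝ, so F is the profile returned.
  set F : ℝ → ℝ := fun r => ∫ s in R..r, k s with hF
  have hFd : ∀ r, HasDerivAt F (k r) r := fun r => hkc.integral_hasStrictDerivAt R r |>.hasDerivAt
  have hzF : ∀ r, z r = F (max R r) := fun r => (congrFun hzT r).symm
  have hFcont : Continuous F := continuous_iff_continuousAt.2 fun r => (hFd r).continuousAt
  have hFB : Continuous fun t => G t * B (F t) := hG.mul (hB_cont.comp hFcont)
  have hcongr : ∀ r, R ≤ r → ∫ t in R..r, G t * B (z t) = ∫ t in R..r, G t * B (F t) := by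
    intro r hr
    refine intervalIntegral.integral_congr fun t ht => ?_
    rw [uIcc_of_le hr] at ht
    simp only [hzF t, max_eq_right ht.1]
  refine ⟨F, k, fun r => c + ∫ t in R..r, G t * B (F t), hkc, hFd, by simp [hF], ?_, ?_, ?_⟩
  · intro r hr
    have harg := radialOperator_integrand_arg_pos hGpos hB0 hc0 z hr
    refine ⟨hχ0 _ harg, ?_⟩
    simp only [hk]
    rw [(hχφ _ harg).2.1, mul_div_cancel₀ _ (hGpos r).ne', hcongr r hr]
  · intro r
    exact ((hFB.integral_hasStrictDerivAt R r).hasDerivAt).const_add c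
  · intro r hr hr1
    rw [← max_eq_right hr, ← hzF r]
    refine (hzw r).trans_lt ?_
    rw [hδ, mul_assoc, ← Real.exp_add]
    refine mul_lt_of_lt_one_right hε (Real.exp_lt_one_iff.2 ?_)
    nlinarith

/-! ### The model metric as a rank-one perturbation of a scalar matrix. -/

section LinearAlgebra

variable {m : ℕ} {n : Fin m → ℝ} {a : ℝ}

/-- Factoring out a, the matrix determinant lemma gives a^m (1 + (1 - a)/a) = a^(m-1). -/
theorem det_smul_one_add_smul_vecMulVec (hm : 1 ≤ m) (hn : n ⬝ᵥ n = 1) (ha : a ≠ 0) :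
    (a • (1 : Matrix (Fin m) (Fin m) ℝ) + (1 - a) • Matrix.vecMulVec n n).det = a ^ (m - 1) := by
  have h : a • (1 : Matrix (Fin m) (Fin m) ℝ) + (1 - a) • Matrix.vecMulVec n n =
      a • (1 + Matrix.replicateCol Unit (((1 - a) / a) • n) * Matrix.replicateRow Unit n) := by
    rw [← Matrix.vecMulVec_eq, Matrix.smul_vecMulVec, smul_add, smul_smul, mul_div_cancel₀ _ ha]
  rw [h, Matrix.det_smul, Matrix.det_one_add_replicateCol_mul_replicateRow, Fintype.card_fin,
    dotProduct_smul, hn]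
  obtain ⟨k, rfl⟩ : ∃ k, m = k + 1 := ⟨m - 1, by omega⟩
  simp only [smul_eq_mul, add_tsub_cancel_right]
  field_simp
  ring

theorem smul_one_add_smul_vecMulVec_mulVec (hn : n ⬝ᵥ n = 1) :
    (a • (1 : Matrix (Fin m) (Fin m) ℝ) + (1 - a) • Matrix.vecMulVec n n) *ᵥ n = n := by
  rw [Matrix.add_mulVec, Matrix.smul_mulVec, Matrix.smul_mulVec, Matrix.one_mulVec,
    Matrix.vecMulVec_mulVec, hn]
  ext i
  simp
  ring

end LinearAlgebra

section ModelMetric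

variable {m : ℕ} {g : ℝ → ℝ} {x : EuclideanSpace ℝ (Fin m)}

theorem unitVector_dotProduct_self (hx : x ≠ 0) :
    (fun i => x i / ‖x‖) ⬝ᵥ (fun i => x i / ‖x‖) = 1 := by
  have hr : ‖x‖ ≠ 0 := norm_ne_zero_iff.2 hx
  have h := EuclideanSpace.real_norm_sq_eq x
  simp only [dotProduct, ← sq, div_pow]
  rw [← Finset.sum_div, ← h, div_self (pow_ne_zero 2 hr)]

/-- This form exhibits the eigenvalue 1 in the radial direction and (g/r)² on its orthogonal
complement. -/
theorem modelMetric_of_ne_zero (hx : x ≠ 0) :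
    modelMetric m g x = ((g ‖x‖ / ‖x‖) ^ 2) • (1 : Matrix (Fin m) (Fin m) ℝ) +
      (1 - (g ‖x‖ / ‖x‖) ^ 2) •
        Matrix.vecMulVec (fun i => x i / ‖x‖) (fun i => x i / ‖x‖) := by
  have hr : ‖x‖ ≠ 0 := norm_ne_zero_iff.2 hx
  ext i j
  simp only [modelMetric, if_neg hx, Matrix.of_apply, Matrix.add_apply, Matrix.smul_apply,
    Matrix.vecMulVec_apply, smul_eq_mul]
  field_simp
  ring

theorem det_modelMetric (hm : 1 ≤ m) (hx : x ≠ 0) (hg : g ‖x‖ ≠ 0) :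
    (modelMetric m g x).det = ((g ‖x‖ / ‖x‖) ^ 2) ^ (m - 1) := by
  rw [modelMetric_of_ne_zero hx]
  exact det_smul_one_add_smul_vecMulVec hm (unitVector_dotProduct_self hx)
    (pow_ne_zero 2 (div_ne_zero hg (norm_ne_zero_iff.2 hx)))

theorem isUnit_det_modelMetric (hm : 1 ≤ m) (hx : x ≠ 0) (hg : g ‖x‖ ≠ 0) :
    IsUnit (modelMetric m g x).det := by
  rw [det_modelMetric hm hx hg]
  exact (pow_ne_zero _ (pow_ne_zero 2 (div_ne_zero hg (norm_ne_zero_iff.2 hx)))).isUnit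

theorem sqrt_det_modelMetric (hm : 1 ≤ m) (hx : x ≠ 0) (hg : 0 < g ‖x‖) :
    Real.sqrt (modelMetric m g x).det = (g ‖x‖ / ‖x‖) ^ (m - 1) := by
  rw [det_modelMetric hm hx hg.ne', ← pow_mul, mul_comm 2, pow_mul, Real.sqrt_sq]
  positivity

theorem modelMetric_mulVec_radial (hx : x ≠ 0) (c : ℝ) :
    modelMetric m g x *ᵥ (fun i => c * (x i / ‖x‖)) = fun i => c * (x i / ‖x‖) := by
  change modelMetric m g x *ᵥ (c • fun i => x i / ‖x‖) = c • fun i => x i / ‖x‖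
  rw [Matrix.mulVec_smul, modelMetric_of_ne_zero hx,
    smul_one_add_smul_vecMulVec_mulVec (unitVector_dotProduct_self hx)]

theorem sharp_modelMetric_radial (hm : 1 ≤ m) (hx : x ≠ 0) (hg : g ‖x‖ ≠ 0) (c : ℝ) :
    (modelMetric m g).sharp x (fun i => c * (x i / ‖x‖)) = fun i => c * (x i / ‖x‖) := by
  conv_lhs => rw [MetricField.sharp, ← modelMetric_mulVec_radial (g := g) hx c]
  rw [Matrix.mulVec_mulVec, Matrix.nonsing_inv_mul _ (isUnit_det_modelMetric hm hx hg),
    Matrix.one_mulVec]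

theorem length_modelMetric_radial (hx : x ≠ 0) {c : ℝ} (hc : 0 ≤ c) :
    (modelMetric m g).length x (fun i => c * (x i / ‖x‖)) = c := by
  rw [MetricField.length, MetricField.inner, modelMetric_mulVec_radial hx]
  change Real.sqrt ((c • fun i => x i / ‖x‖) ⬝ᵥ (c • fun i => x i / ‖x‖)) = c
  rw [dotProduct_smul, smul_dotProduct, unitVector_dotProduct_self hx, smul_eq_mul, smul_eq_mul,
    mul_one, Real.sqrt_mul_self hc]

/-- For a radial function with profile of derivative `c > 0` at `‖x‖`, the flux pairs with a
covector `η` as `φ(c)` times the radial component of `η`. -/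
theorem inner_phiFlux_modelMetric_radial (hm : 1 ≤ m) (hx : x ≠ 0) (hg : g ‖x‖ ≠ 0) (φ : ℝ → ℝ)
    {c : ℝ} (hc : 0 < c) (η : Fin m → ℝ) :
    (modelMetric m g).inner x
      (phiFlux (modelMetric m g) φ x ((modelMetric m g).sharp x (fun i => c * (x i / ‖x‖))))
      ((modelMetric m g).sharp x η) = φ c * ∑ i, x i / ‖x‖ * η i := by
  rw [sharp_modelMetric_radial hm hx hg, phiFlux, length_modelMetric_radial hx hc.le,
    MetricField.inner, MetricField.sharp, Matrix.mulVec_mulVec,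
    Matrix.mul_nonsing_inv _ (isUnit_det_modelMetric hm hx hg), Matrix.one_mulVec, dotProduct,
    Finset.mul_sum]
  refine Finset.sum_congr rfl fun i _ => ?_
  simp only [Pi.smul_apply, smul_eq_mul]
  have := hc.ne'
  field_simp

theorem measurable_density_modelMetric (hm : 1 ≤ m) (hg : IsModelFunction g) :
    Measurable fun x : EuclideanSpace ℝ (Fin m) =>
      ENNReal.ofReal (Real.sqrt (modelMetric m g x).det) := by
  classical
  have hgc : Continuous fun x : EuclideanSpace ℝ (Fin m) => g ‖x‖ :=
    hg.smooth.continuousOn.comp_continuous continuous_norm fun x => mem_Ici.2 (norm_nonneg x)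
  have h : (fun x : EuclideanSpace ℝ (Fin m) =>
      ENNReal.ofReal (Real.sqrt (modelMetric m g x).det)) =
      fun x => if x = 0 then 1 else ENNReal.ofReal ((g ‖x‖ / ‖x‖) ^ (m - 1)) := by
    funext x
    split_ifs with hx
    · simp [modelMetric, hx]
    · rw [sqrt_det_modelMetric hm hx (hg.pos _ (norm_pos_iff.2 hx))]
  rw [h]
  exact Measurable.ite (measurableSet_singleton 0) measurable_const
    ((hgc.measurable.div measurable_norm).pow_const _).ennreal_ofReal

theorem integrable_vol_modelMetric_iff (hm : 1 ≤ m) (hg : IsModelFunction g)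
    {f : EuclideanSpace ℝ (Fin m) → ℝ} :
    Integrable f (modelMetric m g).vol ↔
      Integrable fun x => Real.sqrt (modelMetric m g x).det * f x := by
  rw [MetricField.vol, integrable_withDensity_iff_integrable_smul'
    (measurable_density_modelMetric hm hg) (Filter.Eventually.of_forall fun _ =>
      ENNReal.ofReal_lt_top)]
  simp only [ENNReal.toReal_ofReal (Real.sqrt_nonneg _), smul_eq_mul]

theorem integral_vol_modelMetric (hm : 1 ≤ m) (hg : IsModelFunction g)
    (f : EuclideanSpace ℝ (Fin m) → ℝ) :
    ∫ x, f x ∂(modelMetric m g).vol = ∫ x, Real.sqrt (modelMetric m g x).det * f x := by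
  rw [MetricField.vol, integral_withDensity_eq_integral_toReal_smul
    (measurable_density_modelMetric hm hg) (Filter.Eventually.of_forall fun _ =>
      ENNReal.ofReal_lt_top)]
  simp only [ENNReal.toReal_ofReal (Real.sqrt_nonneg _), smul_eq_mul]

end ModelMetric

/-! ### Test functions and integration by parts. -/

section TestFunction

variable {m : ℕ} {Ω : Set (EuclideanSpace ℝ (Fin m))} {f ψ : EuclideanSpace ℝ (Fin m) → ℝ}

theorem ContinuousOn.integrable_mul_of_tsupport_subset (hf : ContinuousOn f Ω)
    (hψ : Continuous ψ) (hc : HasCompactSupport ψ) (hs : tsupport ψ ⊆ Ω) :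
    Integrable fun x => f x * ψ x := by
  have h : IntegrableOn (fun x => f x * ψ x) (tsupport ψ) :=
    ((hf.mono hs).mul hψ.continuousOn).integrableOn_compact hc
  refine (integrableOn_iff_integrable_of_support_subset fun x hx => ?_).1 h
  exact subset_tsupport ψ fun h0 => hx (by simp [h0])

theorem ContinuousOn.memLp_restrict_of_isCompact {K : Set (EuclideanSpace ℝ (Fin m))}
    (hf : ContinuousOn f K) (hK : IsCompact K) (p : ENNReal) : MemLp f p (volume.restrict K) := by
  have : IsFiniteMeasure (volume.restrict K) :=
    isFiniteMeasure_restrict.2 hK.measure_lt_top.ne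
  obtain ⟨C, hC⟩ := hK.exists_bound_of_continuousOn hf
  exact MemLp.of_bound (hf.aestronglyMeasurable hK.measurableSet) C
    (ae_restrict_of_forall_mem hK.measurableSet hC)

theorem IsTestFunction.continuous_partials (hψ : IsTestFunction Ω ψ) (i : Fin m) :
    Continuous fun x => partials ψ x i :=
  (hψ.smooth.continuous_fderiv (by simp)).clm_apply continuous_const

theorem IsTestFunction.hasCompactSupport_partials (hψ : IsTestFunction Ω ψ) (i : Fin m) :
    HasCompactSupport fun x => partials ψ x i :=
  hψ.compact.fderiv_apply ℝ _

theorem IsTestFunction.tsupport_partials_subset (hψ : IsTestFunction Ω ψ) (i : Fin m) :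
    tsupport (fun x => partials ψ x i) ⊆ Ω :=
  (tsupport_fderiv_apply_subset ℝ _).trans hψ.support

theorem IsTestFunction.apply_eq_zero (hψ : IsTestFunction Ω ψ) {x : EuclideanSpace ℝ (Fin m)}
    (hx : x ∉ Ω) : ψ x = 0 :=
  image_eq_zero_of_notMem_tsupport fun h => hx (hψ.support h)

theorem IsTestFunction.partials_eq_zero (hψ : IsTestFunction Ω ψ)
    {x : EuclideanSpace ℝ (Fin m)} (hx : x ∉ Ω) : partials ψ x = 0 :=
  funext fun i => image_eq_zero_of_notMem_tsupport (f := fun x => partials ψ x i)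
    fun h => hx (hψ.tsupport_partials_subset i h)

theorem IsTestFunction.integrable_mul (hψ : IsTestFunction Ω ψ) (hf : ContinuousOn f Ω) :
    Integrable fun x => f x * ψ x :=
  hf.integrable_mul_of_tsupport_subset hψ.smooth.continuous hψ.compact hψ.support

theorem IsTestFunction.integrable_mul_partials (hψ : IsTestFunction Ω ψ)
    (hf : ContinuousOn f Ω) (i : Fin m) : Integrable fun x => f x * partials ψ x i :=
  hf.integrable_mul_of_tsupport_subset (hψ.continuous_partials i)
    (hψ.hasCompactSupport_partials i) (hψ.tsupport_partials_subset i)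

/-- Directional derivatives of f are needed only on the support of ψ, so singularities of f outside
Ω, such as at the origin, do no harm. -/
theorem IsTestFunction.integral_mul_partials (hψ : IsTestFunction Ω ψ) (hf : ContinuousOn f Ω)
    {f' : EuclideanSpace ℝ (Fin m) → ℝ} (hf' : ContinuousOn f' Ω) {i : Fin m}
    (hd : ∀ x ∈ Ω, HasLineDerivAt ℝ f (f' x) x (EuclideanSpace.single i 1)) :
    ∫ x, f x * partials ψ x i = - ∫ x, f' x * ψ x :=
  integral_bilinear_hasLineDerivAt_right_eq_neg_left_of_integrable
    (B := ContinuousLinearMap.mul ℝ ℝ) (hψ.integrable_mul hf') (hψ.integrable_mul_partials hf i)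
    (hψ.integrable_mul hf) (fun x hx => hd x (hψ.support hx))
    fun x _ => ((hψ.smooth.differentiable (by simp)) x).hasFDerivAt.hasLineDerivAt _

end TestFunction

/-! ### Radial functions and the weak equation. -/

section Radial

variable {m : ℕ} {x : EuclideanSpace ℝ (Fin m)}

theorem hasFDerivAt_norm_of_ne_zero (hx : x ≠ 0) :
    HasFDerivAt (fun y : EuclideanSpace ℝ (Fin m) => ‖y‖) (‖x‖⁻¹ • innerSL ℝ x) x := by
  have hr : ‖x‖ ≠ 0 := norm_ne_zero_iff.2 hx
  have h := (hasStrictFDerivAt_norm_sq x).hasFDerivAt.sqrt (pow_ne_zero 2 hr)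
  simp only [Real.sqrt_sq (norm_nonneg _)] at h
  refine h.congr_fderiv ?_
  ext v
  simp
  field_simp

theorem hasLineDerivAt_comp_norm (hx : x ≠ 0) {a : ℝ → ℝ} {a' : ℝ} (ha : HasDerivAt a a' ‖x‖)
    (i : Fin m) : HasLineDerivAt ℝ (fun y : EuclideanSpace ℝ (Fin m) => a ‖y‖)
      (a' * (x i / ‖x‖)) x (EuclideanSpace.single i 1) := by
  have h := (ha.comp_hasFDerivAt x (hasFDerivAt_norm_of_ne_zero hx)).hasLineDerivAt
    (EuclideanSpace.single i 1)
  convert! h using 1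
  simp [div_eq_inv_mul, EuclideanSpace.inner_single_right]

theorem hasLineDerivAt_comp_norm_mul_coord (hx : x ≠ 0) {a : ℝ → ℝ} {a' : ℝ}
    (ha : HasDerivAt a a' ‖x‖) (i : Fin m) :
    HasLineDerivAt ℝ (fun y : EuclideanSpace ℝ (Fin m) => a ‖y‖ * y i)
      (a' * (x i / ‖x‖) * x i + a ‖x‖) x (EuclideanSpace.single i 1) := by
  have h1 := ha.comp_hasFDerivAt x (hasFDerivAt_norm_of_ne_zero hx)
  have h2 : HasFDerivAt (fun y : EuclideanSpace ℝ (Fin m) => y i)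
      (EuclideanSpace.proj (𝕜 := ℝ) i : EuclideanSpace ℝ (Fin m) →L[ℝ] ℝ) x :=
    (EuclideanSpace.proj (𝕜 := ℝ) i : EuclideanSpace ℝ (Fin m) →L[ℝ] ℝ).hasFDerivAt
  have h := (h1.mul h2).hasLineDerivAt (EuclideanSpace.single i 1)
  convert! h using 1
  simp [EuclideanSpace.inner_single_right]
  field_simp
  ring

theorem norm_pos_of_mem_compl_closedBall {R : ℝ} (hR : 0 < R)
    (hx : x ∈ (Metric.closedBall (0 : EuclideanSpace ℝ (Fin m)) R)ᶜ) : R < ‖x‖ ∧ x ≠ 0 := by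
  have h : R < ‖x‖ := by simpa using hx
  exact ⟨h, norm_pos_iff.1 (hR.trans h)⟩

/-- A radial `C¹` function has its classical gradient as weak gradient outside a ball. -/
theorem hasWeakPartials_comp_norm {z z' : ℝ → ℝ} {R : ℝ} (hR : 0 < R) (p : ℝ)
    (hz : ∀ r, HasDerivAt z (z' r) r) (hz' : Continuous z') :
    HasWeakPartials p (Metric.closedBall (0 : EuclideanSpace ℝ (Fin m)) R)ᶜ (fun x => z ‖x‖)
      (fun x i => z' ‖x‖ * (x i / ‖x‖)) := by
  have hzc : Continuous z := continuous_iff_continuousAt.2 fun r => (hz r).continuousAt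
  have hu : Continuous fun x : EuclideanSpace ℝ (Fin m) => z ‖x‖ := hzc.comp continuous_norm
  have hξ : ∀ i : Fin m, ContinuousOn (fun x : EuclideanSpace ℝ (Fin m) =>
      z' ‖x‖ * (x i / ‖x‖)) (Metric.closedBall 0 R)ᶜ := fun i =>
    (hz'.comp continuous_norm).continuousOn.mul
      (ContinuousOn.div (by fun_prop) continuous_norm.continuousOn fun x hx =>
        norm_ne_zero_iff.2 (norm_pos_of_mem_compl_closedBall hR hx).2)
  exact
    { memLp_fun := fun K hK _ => hu.continuousOn.memLp_restrict_of_isCompact hK _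
      memLp_partial := fun K hK hKΩ i =>
        ((hξ i).mono hKΩ).memLp_restrict_of_isCompact hK _
      integral_eq := fun ψ hψ i => hψ.integral_mul_partials hu.continuousOn (hξ i) fun x hx =>
        hasLineDerivAt_comp_norm (norm_pos_of_mem_compl_closedBall hR hx).2 (hz _) i }

/-- The divergence theorem for the field `H(r) r⁻ᵐ x`, whose divergence is `H'(r) r¹⁻ᵐ`. -/
theorem integral_radialField_mul_partials (hm : 1 ≤ m) {H h : ℝ → ℝ} {R : ℝ} (hR : 0 < R)
    (hH : ∀ r, HasDerivAt H (h r) r) (hh : Continuous h)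
    {ψ : EuclideanSpace ℝ (Fin m) → ℝ} (hψ : IsTestFunction (Metric.closedBall 0 R)ᶜ ψ) :
    (Integrable fun x => ∑ i, H ‖x‖ / ‖x‖ ^ m * x i * partials ψ x i) ∧
    (Integrable fun x => h ‖x‖ / ‖x‖ ^ (m - 1) * ψ x) ∧
    (∫ x, ∑ i, H ‖x‖ / ‖x‖ ^ m * x i * partials ψ x i) =
      - ∫ x, h ‖x‖ / ‖x‖ ^ (m - 1) * ψ x := by
  set Ω := (Metric.closedBall (0 : EuclideanSpace ℝ (Fin m)) R)ᶜ with hΩ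
  have hne : ∀ x ∈ Ω, ‖x‖ ≠ 0 := fun x hx =>
    norm_ne_zero_iff.2 (norm_pos_of_mem_compl_closedBall hR hx).2
  have hHc : Continuous H := continuous_iff_continuousAt.2 fun r => (hH r).continuousAt
  set k' : ℝ → ℝ := fun r => (h r * r ^ m - H r * (m * r ^ (m - 1))) / (r ^ m) ^ 2 with hk'
  have hk : ∀ r, r ≠ 0 → HasDerivAt (fun r => H r / r ^ m) (k' r) r := fun r hr =>
    (hH r).div (hasDerivAt_pow m r) (pow_ne_zero _ hr)
  have hkc : ContinuousOn (fun x : EuclideanSpace ℝ (Fin m) => H ‖x‖ / ‖x‖ ^ m) Ω :=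
    (hHc.comp continuous_norm).continuousOn.div (by fun_prop) fun x hx => pow_ne_zero _ (hne x hx)
  have hk'c : ContinuousOn (fun x : EuclideanSpace ℝ (Fin m) => k' ‖x‖) Ω := by
    refine ContinuousOn.div (Continuous.continuousOn ?_) (by fun_prop)
      fun x hx => pow_ne_zero _ (pow_ne_zero _ (hne x hx))
    have := hh.comp (continuous_norm (E := EuclideanSpace ℝ (Fin m)))
    have := hHc.comp (continuous_norm (E := EuclideanSpace ℝ (Fin m)))
    simp only [Function.comp_def] at *
    fun_prop
  have hV : ∀ i : Fin m, ContinuousOn (fun x : EuclideanSpace ℝ (Fin m) =>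
      H ‖x‖ / ‖x‖ ^ m * x i) Ω := fun i => hkc.mul (by fun_prop)
  have hV' : ∀ i : Fin m, ContinuousOn (fun x : EuclideanSpace ℝ (Fin m) =>
      k' ‖x‖ * (x i / ‖x‖) * x i + H ‖x‖ / ‖x‖ ^ m) Ω := fun i =>
    ((hk'c.mul (ContinuousOn.div (by fun_prop) continuous_norm.continuousOn hne)).mul
      (by fun_prop)).add hkc
  have hint := fun i => hψ.integrable_mul_partials (hV i) i
  have hint' := fun i => hψ.integrable_mul (hV' i)
  -- The divergence: with k = H r^(-m), it equals r k' + m k = h r^(1-m). Off Ω both sides vanish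
  -- with ψ.
  have hsum : ∀ x, ∑ i, (k' ‖x‖ * (x i / ‖x‖) * x i + H ‖x‖ / ‖x‖ ^ m) * ψ x =
      h ‖x‖ / ‖x‖ ^ (m - 1) * ψ x := by
    intro x
    by_cases hx : x ∈ Ω
    · rw [← Finset.sum_mul, Finset.sum_add_distrib]
      congr 1
      have h1 : ∑ i, k' ‖x‖ * (x i / ‖x‖) * x i = k' ‖x‖ * ‖x‖ := by
        have h2 : ∀ i, k' ‖x‖ * (x i / ‖x‖) * x i = k' ‖x‖ / ‖x‖ * x i ^ 2 := fun i => by ring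
        simp only [h2]
        rw [← Finset.mul_sum, ← EuclideanSpace.real_norm_sq_eq]
        have := hne x hx
        field_simp
      rw [h1, Finset.sum_const, Finset.card_univ, Fintype.card_fin, nsmul_eq_mul]
      have := hne x hx
      obtain ⟨n, rfl⟩ : ∃ n, m = n + 1 := ⟨m - 1, by omega⟩
      simp only [hk', add_tsub_cancel_right]
      field_simp
      ring
    · simp [hψ.apply_eq_zero hx]
  have hI : Integrable fun x => h ‖x‖ / ‖x‖ ^ (m - 1) * ψ x := by
    simp only [← hsum]
    exact integrable_finsetSum _ fun i _ => hint' i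
  refine ⟨integrable_finsetSum _ fun i _ => hint i, hI, ?_⟩
  simp only [← hsum]
  rw [integral_finsetSum _ fun i _ => hint i, integral_finsetSum _ fun i _ => hint' i,
    ← Finset.sum_neg_distrib]
  refine Finset.sum_congr rfl fun i _ => hψ.integral_mul_partials (hV i) (hV' i) fun x hx => ?_
  exact hasLineDerivAt_comp_norm_mul_coord (norm_pos_of_mem_compl_closedBall hR hx).2
    (hk _ (hne x hx)) i

/-- A solution of the radial equation gives a weak solution outside a ball of a model manifold. -/
theorem isWeakSolution_comp_norm (hm : 1 ≤ m) {g φ B z z' H h : ℝ → ℝ} (hg : IsModelFunction g)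
    {R : ℝ} (hR : 0 < R) (p : ℝ) (hz : ∀ r, HasDerivAt z (z' r) r) (hz' : Continuous z')
    (hz'pos : ∀ r, R ≤ r → 0 < z' r) (hH : ∀ r, HasDerivAt H (h r) r) (hh : Continuous h)
    (hHeq : ∀ r, R ≤ r → H r = g r ^ (m - 1) * φ (z' r))
    (hheq : ∀ r, R ≤ r → h r = g r ^ (m - 1) * B (z r)) :
    IsWeakSolution (modelMetric m g) p φ B (Metric.closedBall 0 R)ᶜ (fun x => z ‖x‖) := by
  refine ⟨_, hasWeakPartials_comp_norm hR p hz hz', fun ψ hψ => ?_⟩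
  obtain ⟨h1, h2, h3⟩ := integral_radialField_mul_partials hm hR hH hh hψ
  rw [integrable_vol_modelMetric_iff hm hg, integrable_vol_modelMetric_iff hm hg,
    integral_vol_modelMetric hm hg, integral_vol_modelMetric hm hg]
  -- On Ω the density (g/r)^(m-1) times φ(z') is H r^(1-m), and the unit vector x/r supplies the
  -- last factor 1/r; off Ω the partials of ψ vanish.
  have e1 : (fun x => Real.sqrt (modelMetric m g x).det * (modelMetric m g).inner x
      (phiFlux (modelMetric m g) φ x
        ((modelMetric m g).sharp x fun i => z' ‖x‖ * (x i / ‖x‖)))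
      ((modelMetric m g).sharp x (partials ψ x))) =
      fun x => ∑ i, H ‖x‖ / ‖x‖ ^ m * x i * partials ψ x i := by
    funext x
    by_cases hx : x ∈ (Metric.closedBall (0 : EuclideanSpace ℝ (Fin m)) R)ᶜ
    · obtain ⟨hxR, hx0⟩ := norm_pos_of_mem_compl_closedBall hR hx
      have hr : 0 < ‖x‖ := norm_pos_iff.2 hx0
      rw [inner_phiFlux_modelMetric_radial hm hx0 (hg.pos _ hr).ne' φ (hz'pos _ hxR.le),
        sqrt_det_modelMetric hm hx0 (hg.pos _ hr), hHeq _ hxR.le, Finset.mul_sum, Finset.mul_sum]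
      refine Finset.sum_congr rfl fun i _ => ?_
      obtain ⟨n, rfl⟩ : ∃ n, m = n + 1 := ⟨m - 1, by omega⟩
      simp only [add_tsub_cancel_right, div_pow, pow_succ]
      field_simp
    · simp [hψ.partials_eq_zero hx, MetricField.sharp, MetricField.inner]
  have e2 : (fun x => Real.sqrt (modelMetric m g x).det * (B (z ‖x‖) * ψ x)) =
      fun x => h ‖x‖ / ‖x‖ ^ (m - 1) * ψ x := by
    funext x
    by_cases hx : x ∈ (Metric.closedBall (0 : EuclideanSpace ℝ (Fin m)) R)ᶜ
    · obtain ⟨hxR, hx0⟩ := norm_pos_of_mem_compl_closedBall hR hx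
      rw [sqrt_det_modelMetric hm hx0 (hg.pos _ (norm_pos_iff.2 hx0)), hheq _ hxR.le, div_pow]
      ring
    · simp [hψ.apply_eq_zero hx]
  rw [e1, e2, h3]
  exact ⟨h1, h2, neg_add_cancel _⟩

end Radial

/-! ### Assembly. -/

theorem mainTheorem6 (m : ℕ) (hm : 1 ≤ m)
    (g : ℝ → ℝ) (hg : IsModelFunction g) (hg_mono : MonotoneOn g (Set.Ici 0))
    (p : ℝ) (hp : 1 < p)
    (φ : ℝ → ℝ) (hφ_cont : ContinuousOn φ (Set.Ici 0)) (hφ_zero : φ 0 = 0)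
    (hφ_pos : ∀ t, 0 < t → 0 < φ t) (hφ_diff : ContDiffOn ℝ 1 φ (Set.Ioi 0))
    (a₁ a₂ : ℝ) (ha₁ : 0 < a₁) (ha₂ : 0 < a₂)
    (hφ_lower : ∀ t, 0 < t → a₂⁻¹ * t ^ (p - 1) ≤ t * deriv φ t)
    (hφ_upper : ∀ t, 0 < t → t * deriv φ t ≤ a₁ + a₂ * t ^ (p - 1))
    (B : ℝ → ℝ) (hB_cont : ContinuousOn B (Set.Ici 0)) (hB_nonneg : ∀ t, 0 < t → 0 ≤ B t)
    (hB_zero : B 0 = 0) (hB_neg : ∀ t, t < 0 → B t = 0) (hB_mono : Monotone B)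
    (b₁ : ℝ) (hb₁ : 0 < b₁) (hB_le : ∀ t, 0 < t → B t ≤ b₁ * t ^ (p - 1))
    (R R₁ ε : ℝ) (hR : 0 < R) (hR₁ : R < R₁) (hε : 0 < ε) :
    ∃ (u : EuclideanSpace ℝ (Fin m) → ℝ) (z z' : ℝ → ℝ),
      -- `u` is radial, with a profile `z` that is `C¹` and strictly increasing on `[R, ∞)`
      (∀ x, R ≤ ‖x‖ → u x = z ‖x‖) ∧
      StrictMonoOn z (Set.Ici R) ∧
      ContinuousOn z' (Set.Ici R) ∧
      (∀ r ∈ Set.Ici R, HasDerivWithinAt z (z' r) (Set.Ici R) r ∧ 0 < z' r) ∧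
      -- the profile solves the radial form of the equation on `[R, ∞)`
      (∀ r ∈ Set.Ici R, HasDerivWithinAt (fun s => g s ^ (m - 1) * φ (z' s))
        (g r ^ (m - 1) * B (z r)) (Set.Ici R) r) ∧
      -- `u` solves `L_φ u = B(u)` weakly outside the ball of radius `R`
      IsWeakSolution (modelMetric m g) p φ B (Metric.closedBall 0 R)ᶜ u ∧
      (∀ x, R < ‖x‖ → 0 < u x) ∧
      (∀ x ∈ Metric.sphere (0 : EuclideanSpace ℝ (Fin m)) R, u x = 0) ∧
      (∀ x ∈ Metric.ball (0 : EuclideanSpace ℝ (Fin m)) R₁ \ Metric.ball 0 R, u x < ε) := by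
  have hq : 0 < p - 1 := by linarith
  obtain ⟨hφ_mono, hφ_lower'⟩ := strictMonoOn_and_rpow_le_of_rpow_le_mul_deriv hq ha₂ hφ_cont
    hφ_zero (hφ_diff.differentiableOn (by simp)) hφ_lower
  have hB0 : ∀ t, 0 ≤ B t := fun t => by
    rcases lt_trichotomy t 0 with ht | rfl | ht
    exacts [(hB_neg t ht).ge, hB_zero.ge, hB_nonneg t ht]
  have hBc : Continuous B := by
    have h : B = fun t => B (max 0 t) := by
      funext t
      rcases lt_or_ge t 0 with ht | ht
      · rw [max_eq_left ht.le, hB_zero, hB_neg t ht]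
      · rw [max_eq_right ht]
    rw [h]
    exact hB_cont.comp_continuous (by fun_prop) fun t => Set.mem_Ici.2 (le_max_left _ _)
  -- Freezing g at its value g(R) to the left of R gives a weight that is continuous, positive and
  -- nondecreasing on all of ℝ.
  have hmax : ∀ s, 0 < max R s := fun s => hR.trans_le (le_max_left _ _)
  have hG : Continuous fun s => g (max R s) ^ (m - 1) :=
    (hg.smooth.continuousOn.comp_continuous (by fun_prop)
      fun s => Set.mem_Ici.2 (hmax s).le).pow _
  have hGpos : ∀ s, 0 < g (max R s) ^ (m - 1) := fun s => pow_pos (hg.pos _ (hmax s)) _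
  have hGm : Monotone fun s => g (max R s) ^ (m - 1) := fun a b hab =>
    pow_le_pow_left₀ (hg.pos _ (hmax a)).le
      (hg_mono (Set.mem_Ici.2 (hmax a).le) (Set.mem_Ici.2 (hmax b).le)
        (max_le_max le_rfl hab)) _
  obtain ⟨z, z', H, hz'c, hz, hzR, hz'H, hH, hzε⟩ := exists_radial_profile (R := R) (R₁ := R₁) hq
    (mul_pos ha₂ hq) hb₁ hε hφ_cont hφ_zero hφ_mono hφ_lower' hBc hB_mono hB0 hB_le hG hGpos hGm
  have hzc : Continuous z := continuous_iff_continuousAt.2 fun r => (hz r).continuousAt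
  have hHeq : ∀ r, R ≤ r → H r = g r ^ (m - 1) * φ (z' r) := fun r hr => by
    rw [(hz'H r hr).2, max_eq_right hr]
  have hheq : ∀ r, R ≤ r → g (max R r) ^ (m - 1) * B (z r) = g r ^ (m - 1) * B (z r) :=
    fun r hr => by rw [max_eq_right hr]
  have hmono : StrictMonoOn z (Set.Ici R) := by
    refine strictMonoOn_of_deriv_pos (convex_Ici R) hzc.continuousOn fun r hr => ?_
    rw [(hz r).deriv]
    exact (hz'H r (interior_subset hr)).1
  refine ⟨fun x => z ‖x‖, z, z', fun _ _ => rfl, hmono, hz'c.continuousOn,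
    fun r hr => ⟨(hz r).hasDerivWithinAt, (hz'H r hr).1⟩, fun r hr => ?_,
    isWeakSolution_comp_norm hm hg hR p hz hz'c (fun r hr => (hz'H r hr).1) hH
      (hG.mul (hBc.comp hzc)) hHeq hheq, fun x hx => ?_, fun x hx => ?_, fun x hx => ?_⟩
  · rw [← hheq r hr]
    exact (hH r).hasDerivWithinAt.congr (fun s hs => (hHeq s hs).symm) (hHeq r hr).symm
  · rw [← hzR]
    exact hmono Set.self_mem_Ici hx.le hx
  · exact (congrArg z (mem_sphere_zero_iff_norm.1 hx)).trans hzR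
  · have h1 : ‖x‖ < R₁ := mem_ball_zero_iff.1 hx.1
    have h2 : R ≤ ‖x‖ := not_lt.1 fun h => hx.2 (mem_ball_zero_iff.2 h)
    exact hzε _ h2 h1
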